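/- Let $N\ge 3$ be an integer, let $p_0,p_1,p_2,p_3\in[0,1]$, and put $q_m:=1-p_m$. On $\Sigma=\{0,1\}^N$, with indices read modulo $N$, write $m_i(x):=2x_{i-1}+x_{i+1}$ and let $x^i$ be $x$ with its $i$th component replaced by $1-x_i$. The Markov chain in $\Sigma$ with parameter vector $(p_0,p_1,p_2,p_3)$ has one-step transition matrix $$P(x,x^i)=N^{-1}p_{m_i(x)}\ \text{ if }x_i=0,\qquad P(x,x^i)=N^{-1}q_{m_i(x)}\ \text{ if }x_i=1,\qquad i=1,\dots,N,$$ $$P(x,x)=N^{-1}\Big(\sum_{i:x_i=0}q_{m_i(x)}+\sum_{i:x_i=1}p_{m_i(x)}\Big),$$ and $P(x,y)=0$ otherwise. It is called ergodic if it has a unique stationary distribution and, for every initial distribution, the distribution at time $n$ converges to it as $n\to\infty$. Let $(X(n),I(n))_{n\ge0}$ be a Markov chain in $\Sigma\times\{1,\dots,N\}$ that moves from $(x,i)$, for each $j=1,\dots,N$, to $(x^i,j)$ with probability $N^{-1}p_{m_i(x)}$ if $x_i=0$ and $N^{-1}q_{m_i(x)}$ if $x_i=1$, and to $(x,j)$ with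 probability $N^{-1}q_{m_i(x)}$ if $x_i=0$ and $N^{-1}p_{m_i(x)}$ if $x_i=1$. Let $S_n:=\xi_1+\cdots+\xi_n$, where $\xi_k:=1$ (a win) if the component of $X(k)$ with index $I(k-1)$ is $1$, and $\xi_k:=-1$ (a loss) otherwise. Let $\mu^N(p_0,p_1,p_2,p_3)$ denote the constant, when it exists, such that $n^{-1}S_n\to\mu^N(p_0,p_1,p_2,p_3)$ almost surely for every initial distribution. Assume that the Markov chain with parameter vector $(p_0,p_1,p_2,p_3)$ is ergodic. Then $\mu^N(p_0,p_1,p_2,p_3)$ exists, and the following hold. (a) The Markov chain with parameter vector $(q_3,q_2,q_1,q_0)$ is ergodic, $\mu^N(q_3,q_2,q_1,q_0)$ exists, and $$\mu^N(p_0,p_1,p_2,p_3)=-\mu^N(q_3,q_2,q_1,q_0).$$ In particular, if $p_0+p_3=1$ and $p_1+p_2=1$, then $\mu^N(p_0,p_1,p_2,p_3)=0$. (b) $$2\min(p_0,p_1,p_2,p_3)-1\le\mu^N(p_0,p_1,p_2,p_3)\le2\max(p_0,p_1,p_2,p_3)-1.$$ -/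

import Mathlib

open Filter Topology MeasureTheory
open scoped Matrix

noncomputable section

namespace CoopParrondo

section FiniteChains

variable {S : Type*} [Fintype S]

/-- `π` is a stationary distribution of the transition matrix `P`
(probability distributions are row vectors). -/
def IsStationary (P : Matrix S S ℝ) (π : S → ℝ) : Prop :=
  π ∈ stdSimplex ℝ S ∧ π ᵥ* P = π

/-- The finite Markov chain with transition matrix `P` is ergodic: there is a unique stationary
distribution, and the distribution at time `n` converges to it as `n → ∞`, whatever the initial
distribution `ν`. -/
def IsErgodic [DecidableEq S] (P : Matrix S S ℝ) : Prop :=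
  ∃ π : S → ℝ, IsStationary P π ∧ (∀ π', IsStationary P π' → π' = π) ∧
    ∀ ν ∈ stdSimplex ℝ S, Tendsto (fun n : ℕ => ν ᵥ* P ^ n) atTop (𝓝 π)

end FiniteChains

/-- Status of each of the `N` players, `0` = loser and `1` = winner. The players sit in a circle and
are labelled by `Fin N`, whose addition is modulo `N`. -/
abbrev State (N : ℕ) : Type := Fin N → Fin 2

section Model

variable (N : ℕ) [NeZero N] (p : Fin 4 → ℝ)

variable {N} in
/-- `m_i(x) = 2 x_{i-1} + x_{i+1}`, with indices modulo `N`. -/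
def nbr (x : State N) (i : Fin N) : Fin 4 :=
  ⟨2 * (x (i - 1)).val + (x (i + 1)).val, by omega⟩

variable {N} in
/-- The state `x^i`: `x` with the `i`th component flipped. -/
def flip (x : State N) (i : Fin N) : State N :=
  Function.update x i (1 - x i)

variable {N} in
/-- Probability that player `i`, when he plays in state `x`, changes his status: he wins with
probability `p_{m_i(x)}` and loses with probability `q_{m_i(x)} = 1 - p_{m_i(x)}`. -/
def changeProb (x : State N) (i : Fin N) : ℝ :=
  if x i = 0 then p (nbr x i) else 1 - p (nbr x i)

variable {N} in
/-- Probability that player `i`, when he plays in state `x`, keeps his status. -/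
def keepProb (x : State N) (i : Fin N) : ℝ :=
  if x i = 0 then 1 - p (nbr x i) else p (nbr x i)

/-- The one-step transition matrix of the chain with parameter vector `p` on `{0,1}^N`.
The states `x^i` are distinct from each other and from `x`, so at most one summand in the last line
is nonzero. -/
def transition : Matrix (State N) (State N) ℝ := fun x y =>
  if y = x then (N : ℝ)⁻¹ * ∑ i, keepProb p x i
  else ∑ i, if y = flip x i then (N : ℝ)⁻¹ * changeProb p x i else 0

/-- The one-step transition matrix of the chain on `{0,1}^N × {players}`, whose state `(x, i)`
records the statuses and the next player to play. -/
def transitionStar : Matrix (State N × Fin N) (State N × Fin N) ℝ := fun a b =>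
  if b.1 = flip a.1 a.2 then (N : ℝ)⁻¹ * changeProb p a.1 a.2
  else if b.1 = a.1 then (N : ℝ)⁻¹ * keepProb p a.1 a.2
  else 0

variable {N} in
/-- Payoff of a transition `(x, i) → (y, j)`: `1` if player `i` won and `-1` if he lost. He won
precisely when his new status is that of a winner, `y_i = 1`. -/
def payoff (a b : State N × Fin N) : ℝ :=
  if b.1 a.2 = 1 then 1 else -1

/-- `Z = (X, I)` is a Markov chain, with an arbitrary initial distribution, with transition matrix
`transitionStar N p` under the probability measure `ℙ`. -/
structure IsGameChain {Ω : Type*} [MeasurableSpace Ω] (ℙ : Measure Ω)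
    (Z : ℕ → Ω → State N × Fin N) : Prop where
  measurable : ∀ n, Measurable (Z n)
  markov : ∀ (n : ℕ) (a : ℕ → State N × Fin N),
    ℙ.real {ω | ∀ k ≤ n + 1, Z k ω = a k} =
      ℙ.real {ω | ∀ k ≤ n, Z k ω = a k} * transitionStar N p (a n) (a (n + 1))

variable {N} in
/-- Cumulative profit `S_n` of the ensemble of `N` players after `n` turns. -/
def cumProfit {Ω : Type*} (Z : ℕ → Ω → State N × Fin N) (n : ℕ) (ω : Ω) : ℝ :=
  ∑ k ∈ Finset.range n, payoff (Z k ω) (Z (k + 1) ω)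

/-- `m` is the mean parameter in the strong law of large numbers: for the chain with any initial
distribution, `S_n / n → m` almost surely. -/
def IsMeanProfit (m : ℝ) : Prop :=
  ∀ (Ω : Type) [MeasurableSpace Ω] (ℙ : Measure Ω) [IsProbabilityMeasure ℙ]
    (Z : ℕ → Ω → State N × Fin N), IsGameChain N p ℙ Z →
      ∀ᵐ ω ∂ℙ, Tendsto (fun n : ℕ => cumProfit Z n ω / n) atTop (𝓝 m)

/-- `μ^N(p_0, p_1, p_2, p_3)`, the mean profit per turn to the ensemble of `N` players, that is, the
almost sure limit of `S_n / n` (an arbitrary number if there is no such constant limit). -/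
def meanProfit : ℝ := Classical.epsilon (IsMeanProfit N p)

end Model

/-- The parameter vector `(q_3, q_2, q_1, q_0)`, where `q_m = 1 - p_m`. -/
def dual (p : Fin 4 → ℝ) : Fin 4 → ℝ := ![1 - p 3, 1 - p 2, 1 - p 1, 1 - p 0]

end CoopParrondo

end

/-!
Profit is a reward `payoff` collected along the transitions of the chain `(X, I)`. If `u` solves the
Poisson equation `u - P u = f - π f` for the expected payoff `f` of a turn and the stationary
distribution `π` of the chain of statuses, then `S_n - n (π f)` is, up to a bounded telescoping
term, a sum of pairwise orthogonal bounded increments. Its second moment grows linearly, so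
`S_n / n → π f` almost surely. Ergodicity enters only through the fact that harmonic functions are
constant, which makes the Poisson equation solvable.

Interchanging winners and losers turns `p` into its dual and changes the sign of every payoff; this
is (a). Since `f` is an average of numbers `2 p_m - 1`, so is `π f`; this is (b).
-/

namespace CoopParrondo

theorem tendsto_div_of_tendsto_div_sq {u : ℕ → ℝ} {C l : ℝ} (hu : ∀ n, |u (n + 1) - u n| ≤ C)
    (h : Tendsto (fun k : ℕ => u (k ^ 2) / (k ^ 2 : ℕ)) atTop (𝓝 l)) :
    Tendsto (fun n : ℕ => u n / n) atTop (𝓝 l) := by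
  -- Adding `n * C` makes the sequence monotone, so that the monotone criterion applies.
  have hmono : Monotone fun n : ℕ => u n + n * C := monotone_nat_of_le_succ fun n => by
    have := (abs_le.1 (hu n)).1
    push_cast
    linarith
  have hshift : (fun n : ℕ => (u n + n * C) / n) =ᶠ[atTop] fun n : ℕ => u n / n + C := by
    filter_upwards [eventually_ne_atTop 0] with n hn
    rw [add_div, mul_div_cancel_left₀ _ (Nat.cast_ne_zero.2 hn)]
  have hsq : Tendsto (fun k : ℕ => k ^ 2) atTop atTop := tendsto_pow_atTop two_ne_zero
  have hratio : ∀ a : ℝ, 1 < a → ∀ᶠ k : ℕ in atTop, (((k + 1) ^ 2 : ℕ) : ℝ) ≤ a * (k ^ 2 : ℕ) :=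
    fun a ha => by
      have hlim : Tendsto (fun k : ℕ => (1 + 1 / (k : ℝ)) ^ 2) atTop (𝓝 1) := by
        simpa using ((tendsto_one_div_atTop_nhds_zero_nat (𝕜 := ℝ)).const_add 1).pow 2
      filter_upwards [hlim.eventually_le_const ha, eventually_ne_atTop 0] with k hk hk0
      calc (((k + 1) ^ 2 : ℕ) : ℝ) = (1 + 1 / (k : ℝ)) ^ 2 * k ^ 2 := by push_cast; field_simp
        _ ≤ a * (k ^ 2 : ℕ) := by push_cast; gcongr
  have hlim : Tendsto (fun n : ℕ => (u n + n * C) / n) atTop (𝓝 (l + C)) :=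
    tendsto_div_of_monotone_of_exists_subseq_tendsto_div _ _ hmono fun a ha =>
      ⟨_, hratio a ha, hsq, (h.add_const C).congr' (hshift.comp_tendsto hsq).symm⟩
  simpa only [add_sub_cancel_right] using (hlim.congr' hshift).sub_const C

section Orthogonality

variable {Ω : Type*} [MeasurableSpace Ω] {ℙ : Measure Ω}

theorem ae_tendsto_zero_of_summable_integral_sq {F : ℕ → Ω → ℝ} (hF : ∀ k, MemLp (F k) 2 ℙ)
    (hsum : Summable fun k => ∫ ω, F k ω ^ 2 ∂ℙ) :
    ∀ᵐ ω ∂ℙ, Tendsto (fun k => F k ω) atTop (𝓝 0) := by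
  have hfin : ∑' k, eLpNorm (fun ω => F k ω ^ 2) 1 ℙ ≠ ⊤ := by
    simpa only [eLpNorm_one_eq_lintegral_enorm,
      ← ofReal_integral_norm_eq_lintegral_enorm (hF _).integrable_sq, norm_pow, Real.norm_eq_abs,
      sq_abs] using hsum.tsum_ofReal_ne_top
  filter_upwards [summable_norm_of_tsum_eLpNorm_ne_top le_rfl
    (fun k => (hF k).integrable_sq.aestronglyMeasurable) hfin] with ω hω
  have habs := hω.tendsto_atTop_zero.sqrt
  simp only [norm_pow, Real.norm_eq_abs, sq_abs, Real.sqrt_sq_eq_abs, Real.sqrt_zero] at habs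
  exact (tendsto_zero_iff_abs_tendsto_zero _).2 habs

section SecondMoment

variable {ι : Type*} {D : ι → Ω → ℝ}

theorem integral_sum_sq_of_pairwise_orthogonal (hD : ∀ k, MemLp (D k) 2 ℙ)
    (horth : Pairwise fun j k => ∫ ω, D j ω * D k ω ∂ℙ = 0) (s : Finset ι) :
    ∫ ω, (∑ k ∈ s, D k ω) ^ 2 ∂ℙ = ∑ k ∈ s, ∫ ω, D k ω ^ 2 ∂ℙ := by
  have hint : ∀ j k, Integrable (fun ω => D j ω * D k ω) ℙ := fun j k =>
    (hD j).integrable_mul (hD k)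
  simp only [sq, Finset.sum_mul_sum]
  rw [integral_finsetSum _ fun j _ => integrable_finsetSum _ fun k _ => hint j k]
  refine Finset.sum_congr rfl fun j hj => ?_
  rw [integral_finsetSum _ fun k _ => hint j k]
  exact Finset.sum_eq_single_of_mem j hj fun k _ hkj => horth hkj.symm

theorem integral_sum_sq_le_of_pairwise_orthogonal [IsFiniteMeasure ℙ] {C : ℝ}
    (hD : ∀ k, AEStronglyMeasurable (D k) ℙ) (hC : ∀ k, ∀ᵐ ω ∂ℙ, |D k ω| ≤ C)
    (horth : Pairwise fun j k => ∫ ω, D j ω * D k ω ∂ℙ = 0) (s : Finset ι) :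
    ∫ ω, (∑ k ∈ s, D k ω) ^ 2 ∂ℙ ≤ s.card * (ℙ.real Set.univ * C ^ 2) := by
  have hL2 : ∀ k, MemLp (D k) 2 ℙ := fun k => MemLp.of_bound (hD k) C (hC k)
  rw [integral_sum_sq_of_pairwise_orthogonal hL2 horth, ← nsmul_eq_mul]
  refine Finset.sum_le_card_nsmul _ _ _ fun k _ => ?_
  calc ∫ ω, D k ω ^ 2 ∂ℙ ≤ ∫ _, C ^ 2 ∂ℙ :=
        integral_mono_ae (hL2 k).integrable_sq (integrable_const _) <| by
          filter_upwards [hC k] with ω hω using sq_le_sq' (abs_le.1 hω).1 (abs_le.1 hω).2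
    _ = ℙ.real Set.univ * C ^ 2 := integral_const _

end SecondMoment

theorem ae_tendsto_sum_div_of_pairwise_orthogonal [IsFiniteMeasure ℙ] {D : ℕ → Ω → ℝ} {C : ℝ}
    (hD : ∀ k, AEStronglyMeasurable (D k) ℙ) (hC : ∀ k, ∀ᵐ ω ∂ℙ, |D k ω| ≤ C)
    (horth : Pairwise fun j k => ∫ ω, D j ω * D k ω ∂ℙ = 0) :
    ∀ᵐ ω ∂ℙ, Tendsto (fun n : ℕ => (∑ k ∈ Finset.range n, D k ω) / n) atTop (𝓝 0) := by
  -- The second moments of the averages are `O(1 / n)`, hence summable along the squares.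
  let avg : ℕ → Ω → ℝ := fun n ω => (∑ k ∈ Finset.range n, D k ω) / n
  have hsum : ∀ n, MemLp (fun ω => ∑ k ∈ Finset.range n, D k ω) 2 ℙ := fun n =>
    memLp_finsetSum _ fun k _ => MemLp.of_bound (hD k) C (hC k)
  have hL2 : ∀ n, MemLp (avg n) 2 ℙ := fun n => by
    simpa only [avg, div_eq_inv_mul] using (hsum n).const_mul (n : ℝ)⁻¹
  have hmoment : ∀ n : ℕ, ∫ ω, avg n ω ^ 2 ∂ℙ ≤ ℙ.real Set.univ * C ^ 2 * (1 / n) := fun n => by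
    simp only [avg, div_pow, integral_div]
    calc (∫ ω, (∑ k ∈ Finset.range n, D k ω) ^ 2 ∂ℙ) / (n : ℝ) ^ 2
        ≤ n * (ℙ.real Set.univ * C ^ 2) / (n : ℝ) ^ 2 := by
          gcongr
          simpa using integral_sum_sq_le_of_pairwise_orthogonal hD hC horth (Finset.range n)
      _ = ℙ.real Set.univ * C ^ 2 * (1 / n) := by
          rcases eq_or_ne n 0 with rfl | hn
          · simp
          · field_simp
  have hsummable : Summable fun k : ℕ => ∫ ω, avg (k ^ 2) ω ^ 2 ∂ℙ := by
    have hbound : Summable fun k : ℕ => ℙ.real Set.univ * C ^ 2 * (1 / ((k ^ 2 : ℕ) : ℝ)) := by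
      simpa using (Real.summable_nat_pow_inv.2 one_lt_two).mul_left (ℙ.real Set.univ * C ^ 2)
    exact hbound.of_nonneg_of_le (fun _ => integral_nonneg fun _ => sq_nonneg _)
      fun k => hmoment (k ^ 2)
  have hsquares := ae_tendsto_zero_of_summable_integral_sq (fun k => hL2 (k ^ 2)) hsummable
  filter_upwards [hsquares, ae_all_iff.2 hC] with ω hsq hbound
  refine tendsto_div_of_tendsto_div_sq (C := C) (u := fun n => ∑ k ∈ Finset.range n, D k ω)
    (fun n => ?_) hsq
  simpa only [Finset.sum_range_succ, add_sub_cancel_left] using hbound n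

end Orthogonality

section MarkovChains

variable {S T Ω : Type*} {P : Matrix S S ℝ} {Z : ℕ → Ω → S}

/-- The trajectory of `Z` up to and including time `n`. -/
def pathUpTo (Z : ℕ → Ω → S) (n : ℕ) (ω : Ω) : Finset.Iic n → S := fun k => Z k ω

/-- The state at time `n` of a path up to time `n`. -/
def lastState {n : ℕ} (c : Finset.Iic n → S) : S := c ⟨n, Finset.mem_Iic.2 le_rfl⟩

theorem pathUpTo_eq_restrict_iff {n : ℕ} {ω : Ω} {a : ℕ → S} :
    pathUpTo Z n ω = (Finset.Iic n).restrict a ↔ ∀ k ≤ n, Z k ω = a k := by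
  simp [pathUpTo, funext_iff]

variable [MeasurableSpace S] [MeasurableSpace T] [MeasurableSpace Ω] {ℙ : Measure Ω}

/-- `Z` is a Markov chain with transition matrix `P` and arbitrary initial distribution. As in
`IsGameChain`, the Markov property is expressed by path probabilities rather than by conditional
ones, so that no path needs to have positive probability. -/
structure IsMarkovChain (P : Matrix S S ℝ) (ℙ : Measure Ω) (Z : ℕ → Ω → S) : Prop where
  measurable : ∀ n, Measurable (Z n)
  markov : ∀ (n : ℕ) (a : ℕ → S), ℙ.real {ω | ∀ k ≤ n + 1, Z k ω = a k} =
    ℙ.real {ω | ∀ k ≤ n, Z k ω = a k} * P (a n) (a (n + 1))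

theorem IsMarkovChain.comp_equiv [Countable T] [MeasurableSingletonClass T] {e : T ≃ S}
    {Z : ℕ → Ω → T} (hZ : IsMarkovChain (P.submatrix e e) ℙ Z) :
    IsMarkovChain P ℙ fun n ω => e (Z n ω) where
  measurable n := (measurable_of_countable e).comp (hZ.measurable n)
  markov n a := by
    simpa only [← e.eq_symm_apply, Matrix.submatrix_apply, e.apply_symm_apply] using
      hZ.markov n fun k => e.symm (a k)

theorem measurable_pathUpTo (hZ : ∀ n, Measurable (Z n)) (n : ℕ) : Measurable (pathUpTo Z n) :=
  measurable_pi_iff.2 fun k => hZ k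

theorem isMarkovChain_iff_map_pathUpTo [MeasurableSingletonClass S] (hZ : ∀ n, Measurable (Z n)) :
    IsMarkovChain P ℙ Z ↔ ∀ (n : ℕ) (c : Finset.Iic n → S) (b : S),
      (ℙ.map fun ω => (pathUpTo Z n ω, Z (n + 1) ω)).real {(c, b)} =
        (ℙ.map (pathUpTo Z n)).real {c} * P (lastState c) b := by
  have hpath : ∀ (n : ℕ) (a : ℕ → S), (ℙ.map (pathUpTo Z n)).real {(Finset.Iic n).restrict a} =
      ℙ.real {ω | ∀ k ≤ n, Z k ω = a k} := fun n a => by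
    rw [map_measureReal_apply (measurable_pathUpTo hZ n) (measurableSet_singleton _)]
    exact congrArg ℙ.real (Set.ext fun ω => pathUpTo_eq_restrict_iff)
  have hstep : ∀ (n : ℕ) (a : ℕ → S),
      (ℙ.map fun ω => (pathUpTo Z n ω, Z (n + 1) ω)).real {((Finset.Iic n).restrict a, a (n + 1))} =
        ℙ.real {ω | ∀ k ≤ n + 1, Z k ω = a k} := fun n a => by
    rw [map_measureReal_apply ((measurable_pathUpTo hZ n).prodMk (hZ _))
      (measurableSet_singleton _)]
    refine congrArg ℙ.real (Set.ext fun ω => ?_)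
    simp only [Set.mem_preimage, Set.mem_singleton_iff, Prod.mk.injEq, pathUpTo_eq_restrict_iff,
      Set.mem_ofPred_eq, Nat.le_succ_iff, or_imp, forall_and, forall_eq]
  refine ⟨fun h n c b => ?_, fun h => ⟨hZ, fun n a => ?_⟩⟩
  · obtain ⟨a, rfl, rfl⟩ : ∃ a : ℕ → S, (Finset.Iic n).restrict a = c ∧ a (n + 1) = b :=
      ⟨fun k => if hk : k ∈ Finset.Iic n then c ⟨k, hk⟩ else b, by ext; simp, by simp⟩
    rw [hstep, hpath]
    exact h.markov n a
  · rw [← hstep, ← hpath]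
    exact h n _ _

theorem IsMarkovChain.integral_path_succ [Fintype S] [MeasurableSingletonClass S]
    [IsFiniteMeasure ℙ] (hZ : IsMarkovChain P ℙ Z) (n : ℕ) (F : (Finset.Iic n → S) → S → ℝ) :
    ∫ ω, F (pathUpTo Z n ω) (Z (n + 1) ω) ∂ℙ =
      ∫ ω, ∑ b, P (Z n ω) b * F (pathUpTo Z n ω) b ∂ℙ := by
  have hlaw := (isMarkovChain_iff_map_pathUpTo hZ.measurable).1 hZ n
  have hpath := measurable_pathUpTo hZ.measurable n
  calc ∫ ω, F (pathUpTo Z n ω) (Z (n + 1) ω) ∂ℙ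
      = ∫ s, F s.1 s.2 ∂ℙ.map fun ω => (pathUpTo Z n ω, Z (n + 1) ω) :=
        (integral_map (hpath.prodMk (hZ.measurable _)).aemeasurable
          (measurable_of_finite fun s : (Finset.Iic n → S) × S =>
            F s.1 s.2).aestronglyMeasurable).symm
    _ = ∑ c, (ℙ.map (pathUpTo Z n)).real {c} * ∑ b, P (lastState c) b * F c b := by
        rw [integral_fintype .of_finite, Fintype.sum_prod_type]
        simp only [hlaw, smul_eq_mul, Finset.mul_sum, mul_assoc]
    _ = ∫ c, ∑ b, P (lastState c) b * F c b ∂ℙ.map (pathUpTo Z n) := by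
        rw [integral_fintype .of_finite]; rfl
    _ = ∫ ω, ∑ b, P (Z n ω) b * F (pathUpTo Z n ω) b ∂ℙ :=
        integral_map hpath.aemeasurable (measurable_of_finite _).aestronglyMeasurable

section LawOfLargeNumbers

variable [Fintype S] [MeasurableSingletonClass S] [IsFiniteMeasure ℙ]

theorem IsMarkovChain.pairwise_integral_increment_mul_eq_zero (hZ : IsMarkovChain P ℙ Z)
    {d : S → S → ℝ} (hd : ∀ a, ∑ b, P a b * d a b = 0) :
    Pairwise fun j k => ∫ ω, d (Z j ω) (Z (j + 1) ω) * d (Z k ω) (Z (k + 1) ω) ∂ℙ = 0 := by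
  have horth : ∀ j k, j < k →
      ∫ ω, d (Z j ω) (Z (j + 1) ω) * d (Z k ω) (Z (k + 1) ω) ∂ℙ = 0 := fun j k hjk => by
    have h := hZ.integral_path_succ k fun c b =>
      d (c ⟨j, Finset.mem_Iic.2 hjk.le⟩) (c ⟨j + 1, Finset.mem_Iic.2 hjk⟩) * d (lastState c) b
    simp only [mul_left_comm (P _ _), ← Finset.mul_sum] at h
    simpa only [pathUpTo, lastState, hd, mul_zero, integral_zero] using h
  rintro j k hjk
  rcases hjk.lt_or_gt with hjk | hkj
  · exact horth j k hjk
  · simpa only [mul_comm] using horth k j hkj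

theorem IsMarkovChain.ae_tendsto_sum_increment_div (hZ : IsMarkovChain P ℙ Z)
    {d : S → S → ℝ} (hd : ∀ a, ∑ b, P a b * d a b = 0) :
    ∀ᵐ ω ∂ℙ, Tendsto (fun n : ℕ => (∑ k ∈ Finset.range n, d (Z k ω) (Z (k + 1) ω)) / n)
      atTop (𝓝 0) := by
  obtain ⟨C, hC⟩ := (Set.finite_range fun s : S × S => |d s.1 s.2|).bddAbove
  exact ae_tendsto_sum_div_of_pairwise_orthogonal
    (fun k => ((measurable_of_finite fun s : S × S => d s.1 s.2).comp
      ((hZ.measurable k).prodMk (hZ.measurable (k + 1)))).aestronglyMeasurable)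
    (fun k => ae_of_all _ fun ω => hC ⟨(Z k ω, Z (k + 1) ω), rfl⟩)
    (hZ.pairwise_integral_increment_mul_eq_zero hd)

theorem IsMarkovChain.ae_tendsto_sum_reward_div (hZ : IsMarkovChain P ℙ Z)
    (hP : P *ᵥ 1 = 1) {r : S → S → ℝ} {m : ℝ} {g : S → ℝ}
    (hg : ∀ a, ∑ b, P a b * r a b + (P *ᵥ g) a = m + g a) :
    ∀ᵐ ω ∂ℙ, Tendsto (fun n : ℕ => (∑ k ∈ Finset.range n, r (Z k ω) (Z (k + 1) ω)) / n)
      atTop (𝓝 m) := by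
  have hrow : ∀ a, ∑ b, P a b = 1 := fun a => by
    simpa [Matrix.mulVec, dotProduct] using congrFun hP a
  have hd : ∀ a, ∑ b, P a b * (r a b - m + (g b - g a)) = 0 := fun a => by
    simp only [mul_add, mul_sub, Finset.sum_add_distrib, Finset.sum_sub_distrib,
      ← Finset.sum_mul, hrow]
    have hga := hg a
    simp only [Matrix.mulVec, dotProduct] at hga
    linear_combination hga
  obtain ⟨B, hB⟩ := (Set.finite_range fun s : S × S => ‖g s.1 - g s.2‖).bddAbove
  filter_upwards [hZ.ae_tendsto_sum_increment_div hd] with ω hω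
  have htele : Tendsto (fun n : ℕ => (g (Z n ω) - g (Z 0 ω)) / n) atTop (𝓝 0) :=
    squeeze_zero_norm (fun n => by
      rw [norm_div, Real.norm_natCast]
      exact div_le_div_of_nonneg_right (hB ⟨(Z n ω, Z 0 ω), rfl⟩) n.cast_nonneg)
      (tendsto_const_div_atTop_nhds_zero_nat B)
  have hlim := (hω.sub htele).add_const m
  rw [sub_zero, zero_add] at hlim
  refine hlim.congr' ?_
  filter_upwards [eventually_ne_atTop 0] with n hn
  simp only [Finset.sum_add_distrib, Finset.sum_sub_distrib,
    Finset.sum_range_sub fun k => g (Z k ω), Finset.sum_const, Finset.card_range, nsmul_eq_mul]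
  field_simp
  ring

end LawOfLargeNumbers

section Existence

open ProbabilityTheory (Kernel IsMarkovKernel)

variable [Fintype S] [MeasurableSingletonClass S]

/-- The transition matrix `P` as a Markov kernel: the next state of a chain in state `a` is
distributed according to the row `P a`. Negative entries are truncated to `0`. -/
noncomputable def rowKernel (P : Matrix S S ℝ) : Kernel S S where
  toFun a := ∑ b, ENNReal.ofReal (P a b) • Measure.dirac b
  measurable' := measurable_of_finite _

theorem rowKernel_real_singleton {a b : S} (hab : 0 ≤ P a b) :
    (rowKernel P a).real {b} = P a b := by
  classical simp [rowKernel, Measure.real, Set.indicator_apply, hab]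

theorem isMarkovKernel_rowKernel [DecidableEq S] (hP : P ∈ Matrix.rowStochastic ℝ S) :
    IsMarkovKernel (rowKernel P) :=
  ⟨fun a => ⟨by
    simp [rowKernel, ← ENNReal.ofReal_sum_of_nonneg, hP.1,
      Matrix.sum_row_of_mem_rowStochastic hP a]⟩⟩

theorem exists_isMarkovChain [DecidableEq S] [Nonempty S] (hP : P ∈ Matrix.rowStochastic ℝ S) :
    ∃ ℙ : Measure (ℕ → S), IsProbabilityMeasure ℙ ∧ IsMarkovChain P ℙ fun n ω => ω n := by
  have := isMarkovKernel_rowKernel hP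
  let κ (n : ℕ) : Kernel (Finset.Iic n → S) S :=
    (rowKernel P).comap lastState (measurable_pi_apply _)
  have (n : ℕ) : IsMarkovKernel (κ n) := Kernel.IsMarkovKernel.comap _ _
  let ℙ : Measure (ℕ → S) := Kernel.trajMeasure (X := fun _ => S)
    (Measure.dirac (Classical.arbitrary S)) κ
  have hpath : ∀ n, ℙ.map (fun ω => (pathUpTo (fun n ω => ω n) n ω, ω (n + 1))) =
      (ℙ.map (pathUpTo (fun n ω => ω n) n)).compProd (κ n) := fun n =>
    Kernel.map_frestrictLe_trajMeasure_compProd_eq_map_trajMeasure.symm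
  refine ⟨ℙ, inferInstance,
    (isMarkovChain_iff_map_pathUpTo measurable_pi_apply).2 fun n c b => ?_⟩
  rw [hpath, ← Set.singleton_prod_singleton, Measure.real, Measure.compProd_apply_prod
    (measurableSet_singleton c) (measurableSet_singleton b), lintegral_singleton,
    ENNReal.toReal_mul, mul_comm]
  exact congrArg _ (rowKernel_real_singleton (hP.1 _ _))

end Existence

end MarkovChains

section ErgodicChains

variable {S T : Type*} [Fintype S] [Fintype T] {P : Matrix S S ℝ} {π : S → ℝ}

theorem dotProduct_mem_Icc_of_mem_stdSimplex (hπ : π ∈ stdSimplex ℝ S) {f : S → ℝ} {c C : ℝ}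
    (hf : ∀ x, f x ∈ Set.Icc c C) : π ⬝ᵥ f ∈ Set.Icc c C :=
  (convex_Icc c C).sum_mem (fun x _ => hπ.1 x) hπ.2 fun x _ => hf x

theorem eq_dotProduct_of_mulVec_eq_self [DecidableEq S]
    (hlim : ∀ ν ∈ stdSimplex ℝ S, Tendsto (fun n : ℕ => ν ᵥ* P ^ n) atTop (𝓝 π)) {g : S → ℝ}
    (hg : P *ᵥ g = g) (x : S) : g x = π ⬝ᵥ g := by
  have hpow : ∀ n : ℕ, P ^ n *ᵥ g = g := fun n => by
    induction n with
    | zero => rw [pow_zero, Matrix.one_mulVec]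
    | succ n ih => rw [pow_succ, ← Matrix.mulVec_mulVec, hg, ih]
  have hconst : ∀ n : ℕ, (Pi.single x 1 ᵥ* P ^ n) ⬝ᵥ g = g x := fun n => by
    rw [← Matrix.dotProduct_mulVec, hpow, single_one_dotProduct]
  have hcont : Continuous fun ν : S → ℝ => ν ⬝ᵥ g := by fun_prop
  refine tendsto_nhds_unique ?_ ((hcont.tendsto π).comp (hlim _ (single_mem_stdSimplex ℝ x)))
  simpa only [Function.comp_def, hconst] using tendsto_const_nhds

theorem IsStationary.exists_poisson (hπ : IsStationary P π)
    (hharmonic : ∀ g : S → ℝ, P *ᵥ g = g → ∀ x, g x = π ⬝ᵥ g) (f : S → ℝ) :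
    ∃ u : S → ℝ, ∀ x, u x - (P *ᵥ u) x = f x - π ⬝ᵥ f := by
  classical
  -- The rank-one term makes `1 - P` injective, and `π` reads off its value on the solution.
  let A : Matrix S S ℝ := 1 - P + Matrix.replicateRow S π
  have hA : ∀ g, A *ᵥ g = g - P *ᵥ g + Function.const S (π ⬝ᵥ g) := fun g => by
    rw [Matrix.add_mulVec, Matrix.sub_mulVec, Matrix.one_mulVec]
    rfl
  have hπA : ∀ g, π ⬝ᵥ (A *ᵥ g) = π ⬝ᵥ g := fun g => by
    have hconst : π ⬝ᵥ Function.const S (π ⬝ᵥ g) = π ⬝ᵥ g := by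
      simp only [dotProduct, Function.const_apply, ← Finset.sum_mul, hπ.1.2, one_mul]
    rw [hA, dotProduct_add, dotProduct_sub, Matrix.dotProduct_mulVec, hπ.2, sub_self, zero_add,
      hconst]
  have hinj : Function.Injective A.mulVec := by
    refine (injective_iff_map_eq_zero A.mulVecLin).2 fun g (hg : A *ᵥ g = 0) => ?_
    have hπg : π ⬝ᵥ g = 0 := by rw [← hπA, hg, dotProduct_zero]
    have hPg : P *ᵥ g = g := by
      simpa [hπg, hg, sub_eq_zero, eq_comm, Function.const_zero] using hA g
    exact funext fun x => (hharmonic g hPg x).trans hπg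
  obtain ⟨u, hu⟩ :=
    Matrix.mulVec_surjective_iff_isUnit.2 (Matrix.mulVec_injective_iff_isUnit.1 hinj) f
  refine ⟨u, fun x => ?_⟩
  have hx := congrFun (hA u) x
  rw [← hπA u, hu] at hx
  simp only [Pi.add_apply, Pi.sub_apply, Function.const_apply] at hx
  linarith

theorem comp_mem_stdSimplex_iff {e : T ≃ S} : π ∘ e ∈ stdSimplex ℝ T ↔ π ∈ stdSimplex ℝ S := by
  simp only [stdSimplex, Set.mem_ofPred_eq, Function.comp_apply, e.forall_congr_left,
    e.apply_symm_apply, e.sum_comp π]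

theorem comp_vecMul_submatrix (e : T ≃ S) : (π ∘ e) ᵥ* P.submatrix e e = (π ᵥ* P) ∘ e := by
  rw [Matrix.submatrix_vecMul_equiv]
  simp [Function.comp_assoc]

theorem isStationary_submatrix_iff {e : T ≃ S} :
    IsStationary (P.submatrix e e) (π ∘ e) ↔ IsStationary P π := by
  rw [IsStationary, IsStationary, comp_mem_stdSimplex_iff, comp_vecMul_submatrix,
    e.surjective.injective_comp_right.eq_iff]

variable [DecidableEq S] [DecidableEq T]

theorem pow_submatrix_equiv (P : Matrix S S ℝ) (e : T ≃ S) (n : ℕ) :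
    P.submatrix e e ^ n = (P ^ n).submatrix e e :=
  (map_pow (Matrix.reindexAlgEquiv ℝ ℝ e.symm) P n).symm

theorem IsErgodic.submatrix (h : IsErgodic P) (e : T ≃ S) : IsErgodic (P.submatrix e e) := by
  obtain ⟨π, hπ, huniq, hlim⟩ := h
  have hcomp : ∀ ν : T → ℝ, ∃ ν' : S → ℝ, ν' ∘ e = ν := e.injective.surjective_comp_right
  refine ⟨π ∘ e, isStationary_submatrix_iff.2 hπ, fun ν hν => ?_, fun ν hν => ?_⟩
  · obtain ⟨ν, rfl⟩ := hcomp ν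
    rw [huniq ν (isStationary_submatrix_iff.1 hν)]
  · obtain ⟨ν, rfl⟩ := hcomp ν
    simp only [pow_submatrix_equiv, comp_vecMul_submatrix]
    exact ((continuous_pi fun x => continuous_apply (e x)).tendsto π).comp
      (hlim ν (comp_mem_stdSimplex_iff.1 hν))

end ErgodicChains

section Model

open scoped BigOperators

variable {N : ℕ}

theorem flip_ne (x : State N) (i : Fin N) : flip x i ≠ x := by
  have hne : ∀ s : Fin 2, 1 - s ≠ s := by decide
  exact fun h => hne (x i) (by simpa only [flip, Function.update_self] using congrFun h i)

/-- The interchange of winners and losers, `x ↦ 1 - x`. -/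
def compl : State N ≃ State N := Equiv.subLeft 1

theorem compl_apply (x : State N) (i : Fin N) : compl x i = 1 - x i := rfl

theorem flip_compl (x : State N) (i : Fin N) : flip (compl x) i = compl (flip x i) := by
  ext j
  by_cases hj : j = i
  · subst hj; simp [flip, compl_apply]
  · simp [flip, compl_apply, hj]

/-- The interchange of winners and losers on `{0,1}^N × {players}`. -/
def complStar : State N × Fin N ≃ State N × Fin N := compl.prodCongr (Equiv.refl _)

theorem payoff_complStar (a b : State N × Fin N) :
    payoff (complStar a) (complStar b) = -payoff a b := by
  have hone : ∀ s : Fin 2, 1 - s = 1 ↔ ¬s = 1 := by decide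
  change (if 1 - b.1 a.2 = 1 then (1 : ℝ) else -1) = -if b.1 a.2 = 1 then 1 else -1
  simp only [hone, ite_not, neg_ite, neg_neg]

variable [NeZero N] {p : Fin 4 → ℝ}

theorem changeProb_add_keepProb (p : Fin 4 → ℝ) (x : State N) (i : Fin N) :
    changeProb p x i + keepProb p x i = 1 := by
  unfold changeProb keepProb
  split_ifs <;> ring

/-- The expected value of `u` at the next state when player `i` plays in state `x`. -/
noncomputable def afterTurn (p : Fin 4 → ℝ) (u : State N → ℝ) (x : State N) (i : Fin N) : ℝ :=
  changeProb p x i * u (flip x i) + keepProb p x i * u x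

/-- The expected payoff of a turn played in state `x` by a uniformly chosen player: player `i` wins
with probability `p_{m_i(x)}`. -/
noncomputable def drift (p : Fin 4 → ℝ) (x : State N) : ℝ :=
  𝔼 i, (2 * p (nbr x i) - 1)

theorem drift_mem_Icc {c C : ℝ} (hp : ∀ m, p m ∈ Set.Icc c C) (x : State N) :
    drift p x ∈ Set.Icc (2 * c - 1) (2 * C - 1) :=
  ⟨Finset.le_expect Finset.univ_nonempty fun i _ => by linarith [(hp (nbr x i)).1],
    Finset.expect_le Finset.univ_nonempty fun i _ => by linarith [(hp (nbr x i)).2]⟩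

theorem transition_mulVec (p : Fin 4 → ℝ) (u : State N → ℝ) (x : State N) :
    (transition N p *ᵥ u) x = 𝔼 i, afterTurn p u x i := by
  have hsplit : ∀ y, transition N p x y * u y =
      (∑ i, if y = flip x i then (N : ℝ)⁻¹ * changeProb p x i * u y else 0) +
        if y = x then ∑ i, (N : ℝ)⁻¹ * keepProb p x i * u y else 0 := fun y => by
    unfold transition
    split_ifs with hy
    · simp [hy, (flip_ne x _).symm, Finset.mul_sum, Finset.sum_mul]
    · simp only [Finset.sum_mul, ite_mul, zero_mul, add_zero]
  simp only [Matrix.mulVec, dotProduct, hsplit]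
  rw [Finset.sum_add_distrib, Finset.sum_comm]
  simp only [Finset.sum_ite_eq', Finset.mem_univ, if_true, ← Finset.sum_add_distrib, mul_assoc,
    ← mul_add, ← Finset.mul_sum, afterTurn, Fintype.expect_eq_sum_div_card, Fintype.card_fin,
    div_eq_inv_mul]

theorem transitionStar_mulVec (p : Fin 4 → ℝ) (F : State N × Fin N → ℝ) (a : State N × Fin N) :
    (transitionStar N p *ᵥ F) a = afterTurn p (fun y => 𝔼 j, F (y, j)) a.1 a.2 := by
  have hsplit : ∀ b : State N × Fin N, transitionStar N p a b * F b =
      (if b.1 = flip a.1 a.2 then (N : ℝ)⁻¹ * changeProb p a.1 a.2 * F b else 0) +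
        if b.1 = a.1 then (N : ℝ)⁻¹ * keepProb p a.1 a.2 * F b else 0 := fun b => by
    unfold transitionStar
    split_ifs with hflip hstay
    · exact absurd (hflip.symm.trans hstay) (flip_ne _ _)
    all_goals ring
  simp only [Matrix.mulVec, dotProduct, hsplit]
  rw [Fintype.sum_prod_type_right]
  simp only [Finset.sum_add_distrib, Finset.sum_ite_eq', Finset.mem_univ, if_true,
    ← Finset.mul_sum, afterTurn, Fintype.expect_eq_sum_div_card, Fintype.card_fin]
  ring

theorem transitionStar_mulVec_one (p : Fin 4 → ℝ) : transitionStar N p *ᵥ 1 = 1 := by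
  ext a
  simp [transitionStar_mulVec, afterTurn, changeProb_add_keepProb]

theorem transitionStar_mem_rowStochastic (hp : ∀ m, p m ∈ Set.Icc (0 : ℝ) 1) :
    transitionStar N p ∈ Matrix.rowStochastic ℝ (State N × Fin N) := by
  have hp0 := fun m => (hp m).1
  have hq0 := fun m => sub_nonneg.2 (hp m).2
  refine ⟨fun a b => ?_, transitionStar_mulVec_one p⟩
  unfold transitionStar changeProb keepProb
  split_ifs <;> first | exact le_rfl | exact mul_nonneg (by positivity) (by simp only [hp0, hq0])

theorem sum_transitionStar_mul_payoff (p : Fin 4 → ℝ) (a : State N × Fin N) :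
    ∑ b, transitionStar N p a b * payoff a b = 2 * p (nbr a.1 a.2) - 1 := by
  have hstatus : a.1 a.2 = 0 ∨ a.1 a.2 = 1 := by
    generalize a.1 a.2 = s
    revert s
    decide
  refine (transitionStar_mulVec p (payoff a) a).trans ?_
  rcases hstatus with h | h <;> simp [afterTurn, changeProb, keepProb, payoff, flip, h] <;> ring

section LawOfLargeNumbers

theorem isGameChain_iff_isMarkovChain {Ω : Type*} [MeasurableSpace Ω] {ℙ : Measure Ω}
    {Z : ℕ → Ω → State N × Fin N} :
    IsGameChain N p ℙ Z ↔ IsMarkovChain (transitionStar N p) ℙ Z :=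
  ⟨fun h => ⟨h.measurable, h.markov⟩, fun h => ⟨h.measurable, h.markov⟩⟩

theorem isMeanProfit_of_poisson {m : ℝ} {u : State N → ℝ}
    (hu : ∀ x, u x - (transition N p *ᵥ u) x = drift p x - m) : IsMeanProfit N p m := by
  intro Ω _ ℙ _ Z hZ
  -- Averaging `g` over the next player gives back `u`, so one step of the chain maps `g` to
  -- `afterTurn p u`.
  let g (a : State N × Fin N) : ℝ := 2 * p (nbr a.1 a.2) - 1 - m + afterTurn p u a.1 a.2
  have hg : ∀ y, 𝔼 j, g (y, j) = u y := fun y => by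
    have hy := hu y
    rw [transition_mulVec, drift] at hy
    simp only [g, Finset.expect_add_distrib, Finset.expect_sub_distrib,
      Fintype.expect_const] at hy ⊢
    linarith
  refine (isGameChain_iff_isMarkovChain.1 hZ).ae_tendsto_sum_reward_div
    (transitionStar_mulVec_one p) (g := g) fun a => ?_
  rw [sum_transitionStar_mul_payoff, transitionStar_mulVec]
  simp only [hg, g]
  ring

theorem IsErgodic.exists_isMeanProfit (herg : IsErgodic (transition N p)) :
    ∃ π ∈ stdSimplex ℝ (State N), IsMeanProfit N p (π ⬝ᵥ drift p) := by
  obtain ⟨π, hπ, -, hlim⟩ := herg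
  obtain ⟨u, hu⟩ := hπ.exists_poisson (fun _ => eq_dotProduct_of_mulVec_eq_self hlim) (drift p)
  exact ⟨π, hπ.1, isMeanProfit_of_poisson hu⟩

theorem IsMeanProfit.isMeanProfit_meanProfit {m : ℝ} (h : IsMeanProfit N p m) :
    IsMeanProfit N p (meanProfit N p) :=
  Classical.epsilon_spec ⟨m, h⟩

theorem IsMeanProfit.unique (hp : ∀ m, p m ∈ Set.Icc (0 : ℝ) 1) {m m' : ℝ}
    (h : IsMeanProfit N p m) (h' : IsMeanProfit N p m') : m = m' := by
  obtain ⟨ℙ, _, hZ⟩ := exists_isMarkovChain (transitionStar_mem_rowStochastic (N := N) hp)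
  have hgame := isGameChain_iff_isMarkovChain.2 hZ
  obtain ⟨ω, hω, hω'⟩ := ((h _ ℙ _ hgame).and (h' _ ℙ _ hgame)).exists
  exact tendsto_nhds_unique hω hω'

theorem IsMeanProfit.meanProfit_eq (hp : ∀ m, p m ∈ Set.Icc (0 : ℝ) 1) {m : ℝ}
    (h : IsMeanProfit N p m) : meanProfit N p = m :=
  h.isMeanProfit_meanProfit.unique hp h

end LawOfLargeNumbers

section Duality

theorem dual_apply (p : Fin 4 → ℝ) (m : Fin 4) : dual p m = 1 - p m.rev := by
  fin_cases m <;> rfl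

theorem dual_mem_Icc (hp : ∀ m, p m ∈ Set.Icc (0 : ℝ) 1) (m : Fin 4) :
    dual p m ∈ Set.Icc (0 : ℝ) 1 := by
  rw [dual_apply]
  exact ⟨sub_nonneg.2 (hp _).2, sub_le_self _ (hp _).1⟩

theorem dual_eq_self (h03 : p 0 + p 3 = 1) (h12 : p 1 + p 2 = 1) : dual p = p := by
  ext m
  fin_cases m <;> simp only [dual, Fin.reduceFinMk, Matrix.cons_val] <;> linarith

theorem nbr_compl (x : State N) (i : Fin N) : nbr (compl x) i = (nbr x i).rev := by
  have hrev : ∀ s t : Fin 2, (⟨2 * (1 - s).val + (1 - t).val, by omega⟩ : Fin 4) =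
      Fin.rev ⟨2 * s.val + t.val, by omega⟩ := by decide
  exact hrev _ _

theorem one_sub_eq_zero_iff (s : Fin 2) : 1 - s = 0 ↔ ¬s = 0 := by
  revert s
  decide

theorem changeProb_dual (p : Fin 4 → ℝ) (x : State N) (i : Fin N) :
    changeProb (dual p) x i = changeProb p (compl x) i := by
  simp only [changeProb, dual_apply, nbr_compl, compl_apply, one_sub_eq_zero_iff, ite_not,
    sub_sub_cancel]

theorem keepProb_dual (p : Fin 4 → ℝ) (x : State N) (i : Fin N) :
    keepProb (dual p) x i = keepProb p (compl x) i := by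
  simp only [keepProb, dual_apply, nbr_compl, compl_apply, one_sub_eq_zero_iff, ite_not,
    sub_sub_cancel]

theorem transition_dual (p : Fin 4 → ℝ) :
    transition N (dual p) = (transition N p).submatrix compl compl := by
  ext x y
  simp only [transition, Matrix.submatrix_apply, changeProb_dual, keepProb_dual, flip_compl,
    EmbeddingLike.apply_eq_iff_eq]

theorem IsErgodic.dual (herg : IsErgodic (transition N p)) :
    IsErgodic (transition N (dual p)) := by
  rw [transition_dual]
  exact herg.submatrix compl

theorem transitionStar_dual (p : Fin 4 → ℝ) :
    transitionStar N (dual p) = (transitionStar N p).submatrix complStar complStar := by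
  ext a b
  simp only [transitionStar, Matrix.submatrix_apply, complStar, Equiv.prodCongr_apply,
    Prod.map_apply', Equiv.coe_refl, id_eq, changeProb_dual, keepProb_dual, flip_compl,
    EmbeddingLike.apply_eq_iff_eq]

theorem IsMeanProfit.dual {m : ℝ} (h : IsMeanProfit N p m) : IsMeanProfit N (dual p) (-m) := by
  intro Ω _ ℙ _ Z hZ
  have hcompl : IsMarkovChain (transitionStar N p) ℙ fun n ω => complStar (Z n ω) := by
    rw [isGameChain_iff_isMarkovChain, transitionStar_dual] at hZ
    exact hZ.comp_equiv
  filter_upwards [h Ω ℙ _ (isGameChain_iff_isMarkovChain.2 hcompl)] with ω hω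
  simpa only [cumProfit, payoff_complStar, Finset.sum_neg_distrib, neg_div, neg_neg] using hω.neg

theorem IsMeanProfit.meanProfit_dual (hp : ∀ m, p m ∈ Set.Icc (0 : ℝ) 1) {m : ℝ}
    (h : IsMeanProfit N p m) : meanProfit N (CoopParrondo.dual p) = -m :=
  h.dual.meanProfit_eq (dual_mem_Icc hp)

end Duality

theorem apply_mem_Icc_min_max {α : Type*} [LinearOrder α] (p : Fin 4 → α) (m : Fin 4) :
    p m ∈ Set.Icc (min (min (p 0) (p 1)) (min (p 2) (p 3)))
      (max (max (p 0) (p 1)) (max (p 2) (p 3))) := by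
  fin_cases m <;> simp

end Model

end CoopParrondo

theorem mainTheorem8 (N : ℕ) [NeZero N] (hN : 3 ≤ N) (p : Fin 4 → ℝ)
    (hp : ∀ m, p m ∈ Set.Icc (0 : ℝ) 1)
    (herg : CoopParrondo.IsErgodic (CoopParrondo.transition N p)) :
    -- the mean parameter is well defined: the strong law of large numbers holds with it
    CoopParrondo.IsMeanProfit N p (CoopParrondo.meanProfit N p) ∧
    -- (a)
    (CoopParrondo.IsErgodic (CoopParrondo.transition N (CoopParrondo.dual p)) ∧
      CoopParrondo.IsMeanProfit N (CoopParrondo.dual p)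
        (CoopParrondo.meanProfit N (CoopParrondo.dual p)) ∧
      CoopParrondo.meanProfit N p = -CoopParrondo.meanProfit N (CoopParrondo.dual p) ∧
      (p 0 + p 3 = 1 → p 1 + p 2 = 1 → CoopParrondo.meanProfit N p = 0)) ∧
    -- (b)
    (2 * min (min (p 0) (p 1)) (min (p 2) (p 3)) - 1 ≤ CoopParrondo.meanProfit N p ∧
      CoopParrondo.meanProfit N p ≤ 2 * max (max (p 0) (p 1)) (max (p 2) (p 3)) - 1) := by
  obtain ⟨π, hπ, hm⟩ := herg.exists_isMeanProfit
  have hmean := hm.meanProfit_eq hp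
  have hneg : CoopParrondo.meanProfit N p = -CoopParrondo.meanProfit N (CoopParrondo.dual p) := by
    rw [hmean, hm.meanProfit_dual hp, neg_neg]
  have hbounds := CoopParrondo.dotProduct_mem_Icc_of_mem_stdSimplex hπ
    (CoopParrondo.drift_mem_Icc (CoopParrondo.apply_mem_Icc_min_max p))
  rw [← hmean] at hbounds
  refine ⟨hm.isMeanProfit_meanProfit,
    ⟨herg.dual, hm.dual.isMeanProfit_meanProfit, hneg, fun h03 h12 => ?_⟩, hbounds⟩
  rw [CoopParrondo.dual_eq_self h03 h12] at hneg
  linarith
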